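/- Consider the following network in $\mathbb R^2$ with a base station at the origin. An uplink user is uniformly distributed in the disk of radius $R>0$ centred at the origin; $d_{0,0}$ is its distance to the origin, $p_0\ge 0$ its random transmit power and $h_{0,0}\sim\mathcal{CN}(0,1)$ its fading coefficient. D2D transmitters are located at the points $x_1,x_2,\dots$ of a homogeneous Poisson point process on $\mathbb R^2$ with density $\lambda>0$; transmitter $k$ has random power $p_k\ge 0$ and fading coefficient $h_{0,k}\sim\mathcal{CN}(0,1)$. The powers $p_1,p_2,\dots$ are identically distributed, and the user's location, $p_0$, $h_{0,0}$, the point process $(x_k)_k$, and all the $p_k$ and $h_{0,k}$, $k\ge1$, are mutually independent. Let $\alpha>2$, let $\sigma^2\ge 0$ be the noise power, let $\beta_0\ge 0$, and let $$\mathrm{SINR}_0=\frac{p_0|h_{0,0}|^2d_{0,0}^{-\alpha}}{\sum_{k}p_k|h_{0,k}|^2\|x_k\|^{-\alpha}+\sigma^2},$$ with values in $[0,\infty]$, where it is assumed that almost surely the numerator and the denominator are not both $0$. (This holds, for example, if $p_0>0$ almost surely or if $\sigma^2>0$.) Put $$a_1=\sigma^2\beta_0,\qquad a_2=\frac{\pi\lambda\beta_0^{2/\alpha}}{\operatorname{sinc}(2/\alpha)}\,\mathbb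 E\big[p_k^{2/\alpha}\big],\qquad \operatorname{sinc}(t)=\frac{\sin \pi t}{\pi t}.$$ Then the cellular coverage probability satisfies $$\mathbb P(\mathrm{SINR}_0\ge\beta_0)\;\ge\;\exp\!\Big(-a_1\tfrac{2}{2+\alpha}R^{\alpha}\,\mathbb E[p_0^{-1}]-a_2\big(\tfrac{2}{2+\alpha}\big)^{2/\alpha}R^{2}\,\big(\mathbb E[p_0^{-1}]\big)^{2/\alpha}\Big).$$ Here the expectations may be infinite, with the conventions $0^{-1}=\infty$, $0\cdot\infty=0$ and $e^{-\infty}=0$. -/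

import Mathlib

open MeasureTheory ProbabilityTheory
open scoped ENNReal NNReal

noncomputable section

/-- The plane `ℝ²` with its Euclidean norm. -/
abbrev Plane : Type := EuclideanSpace ℝ (Fin 2)

/-- The circularly symmetric complex Gaussian law `CN(0,1)`: independent real and imaginary parts,
each of law `N(0,1/2)`. -/
def stdComplexGaussian : Measure ℂ :=
  ((gaussianReal 0 (1 / 2)).prod (gaussianReal 0 (1 / 2))).map (fun z : ℝ × ℝ => (⟨z.1, z.2⟩ : ℂ))

/-- The number (possibly infinite) of points of the random sequence `x` that lie in `B`. -/
def pointCount {Ω : Type*} (x : ℕ → Ω → Plane) (B : Set Plane) (ω : Ω) : ℕ∞ :=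
  {k : ℕ | x k ω ∈ B}.encard

/-- The random points `x 0, x 1, …` are the points of a homogeneous Poisson point process of
density `lam` on the whole plane: the number of points in a Borel set of finite area is Poisson
with mean `lam * area`, and the numbers of points in disjoint sets are independent. -/
structure IsHomogeneousPPP {Ω : Type*} [MeasurableSpace Ω] (P : Measure Ω)
    (x : ℕ → Ω → Plane) (lam : ℝ≥0) : Prop where
  measurable_point : ∀ k, Measurable (x k)
  count_law : ∀ B : Set Plane, MeasurableSet B → volume B ≠ ∞ → ∀ n : ℕ,
    P {ω | pointCount x B ω = n} = poissonMeasure (lam * (volume B).toNNReal) {n}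
  count_indep : ∀ (m : ℕ) (B : Fin m → Set Plane), (∀ i, MeasurableSet (B i)) →
    (∀ i, volume (B i) ≠ ∞) → Pairwise (fun i j => Disjoint (B i) (B j)) →
    iIndepFun (fun i => pointCount x (B i)) P

/-- The random quantities that determine the uplink of a D2D underlaid cell whose base station is
at the origin. -/
structure UplinkNetwork (Ω : Type*) where
  /-- location of the uplink cellular user -/
  user : Ω → Plane
  /-- transmit power `p₀` of the uplink user -/
  userPower : Ω → ℝ≥0
  /-- fading `h₀₀` from the uplink user to the base station -/
  userFading : Ω → ℂ
  /-- locations of the D2D transmitters -/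
  point : ℕ → Ω → Plane
  /-- transmit power `p_k` of D2D transmitter `k` -/
  power : ℕ → Ω → ℝ≥0
  /-- fading `h₀ₖ` from D2D transmitter `k` to the base station -/
  fading : ℕ → Ω → ℂ

/-- Labels for the independent sources of randomness. -/
inductive Source : Type
  | user : Source
  | userPower : Source
  | userFading : Source
  | points : Source
  | power (k : ℕ) : Source
  | fading (k : ℕ) : Source

namespace UplinkNetwork

variable {Ω : Type*}

/-- The σ-algebra generated by each source of randomness (all D2D locations form one source). -/
abbrev sigmaAlgebra (N : UplinkNetwork Ω) : Source → MeasurableSpace Ω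
  | .user => MeasurableSpace.comap N.user inferInstance
  | .userPower => MeasurableSpace.comap N.userPower inferInstance
  | .userFading => MeasurableSpace.comap N.userFading inferInstance
  | .points => MeasurableSpace.comap (fun ω k => N.point k ω) inferInstance
  | .power k => MeasurableSpace.comap (N.power k) inferInstance
  | .fading k => MeasurableSpace.comap (N.fading k) inferInstance

/-- The stochastic model: the user is uniform in the disk of radius `R`, the D2D transmitters form
a homogeneous Poisson process of density `lam`, the fading variables are `CN(0,1)`, the D2D powers
are identically distributed, and all sources of randomness are mutually independent. -/
structure IsModel [MeasurableSpace Ω] (N : UplinkNetwork Ω) (P : Measure Ω)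
    (lam : ℝ≥0) (R : ℝ) : Prop where
  measurable_user : Measurable N.user
  measurable_userPower : Measurable N.userPower
  measurable_userFading : Measurable N.userFading
  measurable_power : ∀ k, Measurable (N.power k)
  measurable_fading : ∀ k, Measurable (N.fading k)
  user_uniform : pdf.IsUniform N.user (Metric.closedBall 0 R) P volume
  points_poisson : IsHomogeneousPPP P N.point lam
  userFading_law : P.map N.userFading = stdComplexGaussian
  fading_law : ∀ k, P.map (N.fading k) = stdComplexGaussian
  power_identDistrib : ∀ j k, IdentDistrib (N.power j) (N.power k) P P
  indep : iIndep N.sigmaAlgebra P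

/-- Received power of the uplink signal, `p₀ |h₀₀|² d₀₀^(-α)`. -/
def signal (N : UplinkNetwork Ω) (α : ℝ) (ω : Ω) : ℝ≥0∞ :=
  N.userPower ω * ‖N.userFading ω‖ₑ ^ 2 * ‖N.user ω‖ₑ ^ (-α)

/-- Total received D2D interference, `∑ₖ pₖ |h₀ₖ|² ‖xₖ‖^(-α)`. -/
def interference (N : UplinkNetwork Ω) (α : ℝ) (ω : Ω) : ℝ≥0∞ :=
  ∑' k, N.power k ω * ‖N.fading k ω‖ₑ ^ 2 * ‖N.point k ω‖ₑ ^ (-α)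

/-- The uplink SINR, with noise power `noise = σ²`, as an extended nonnegative number
(`c / 0 = ∞` for `c > 0`). -/
def sinr (N : UplinkNetwork Ω) (α : ℝ) (noise : ℝ≥0) (ω : Ω) : ℝ≥0∞ :=
  N.signal α ω / (N.interference α ω + noise)

/-- The cellular coverage probability `ℙ(SINR₀ ≥ β₀)`. -/
def coverageProb [MeasurableSpace Ω] (N : UplinkNetwork Ω) (P : Measure Ω) (α : ℝ)
    (noise β₀ : ℝ≥0) : ℝ≥0∞ :=
  P {ω | (β₀ : ℝ≥0∞) ≤ N.sinr α noise ω}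

end UplinkNetwork

/-- The normalized cardinal sine, `sin (π t) / (π t)`. -/
def nsinc (t : ℝ) : ℝ := Real.sinc (Real.pi * t)

end

/-! Put s = β₀ d₀₀^α / p₀. Almost surely, when p₀ ≠ 0, coverage contains the event |h₀₀|² ≥ s (I +
σ²), where I is the interference. Since |h₀₀|² is Exp(1) and independent of the rest, this event has
probability E exp(-s (I + σ²)) (`measure_le_enorm_userFading_sq`).

As s and I are independent, s can be frozen. Averaging over the marks p_k |h₀ₖ|² and using the
Laplace functional of the Poisson process gives E exp(-s I) ≥ exp(-A s^(2/α)), with A = πλ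
E[p_k^(2/α)] / sinc(2/α) (`negExp_le_lintegral_interference`). Only this direction is needed, so
approximating from below by simple functions suffices.

Jensen for exp(-·) and then for the concave power 2/α ≤ 1 bounds E exp(-(σ² s + A s^(2/α))) below by
exp(-(σ² E s + A (E s)^(2/α))). Finally E s = β₀ · 2/(2+α) R^α · E[p₀⁻¹], by independence and a
polar integral.

If E[p₀⁻¹] = ∞, the bound is trivial unless both coefficients vanish. Then either β₀ = 0, or there
is neither noise nor interference; coverage is certain in both cases. -/

/-- `exp (-t)` for an extended nonnegative number `t`. -/
noncomputable def negExp (t : ℝ≥0∞) : ℝ≥0∞ := EReal.exp (-(t : EReal))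

/-! ### The exponential exp(-t) on [0, ∞], and Jensen's inequality for it. -/

namespace negExp

@[simp] lemma zero : negExp 0 = 1 := by simp [negExp]

@[simp] lemma top : negExp ∞ = 0 := by simp [negExp]

lemma ofReal {x : ℝ} (hx : 0 ≤ x) :
    negExp (ENNReal.ofReal x) = ENNReal.ofReal (Real.exp (-x)) := by
  rw [negExp, EReal.coe_ennreal_ofReal, max_eq_left hx, ← EReal.coe_neg, EReal.exp_coe]

lemma coe (x : ℝ≥0) : negExp x = ENNReal.ofReal (Real.exp (-x)) := by
  simpa using ofReal x.2

lemma antitone : Antitone negExp := fun _ _ h =>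
  EReal.exp_monotone (EReal.neg_le_neg_iff.2 (EReal.coe_ennreal_le_coe_ennreal_iff.2 h))

lemma continuous : Continuous negExp :=
  ENNReal.continuous_exp.comp (continuous_neg.comp continuous_coe_ennreal_ereal)

@[fun_prop] lemma measurable : Measurable negExp := continuous.measurable

lemma le_one (t : ℝ≥0∞) : negExp t ≤ 1 := zero ▸ antitone (zero_le : 0 ≤ t)

lemma ne_top (t : ℝ≥0∞) : negExp t ≠ ∞ := ((le_one t).trans_lt ENNReal.one_lt_top).ne

lemma add (s t : ℝ≥0∞) : negExp (s + t) = negExp s * negExp t := by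
  induction s
  · simp
  induction t
  · simp
  rw [← ENNReal.coe_add, coe, coe, coe, ← ENNReal.ofReal_mul (Real.exp_pos _).le, ← Real.exp_add,
    NNReal.coe_add, neg_add]

lemma sum {ι : Type*} (s : Finset ι) (f : ι → ℝ≥0∞) :
    negExp (∑ i ∈ s, f i) = ∏ i ∈ s, negExp (f i) := by
  classical
  induction s using Finset.induction_on with
  | empty => simp
  | insert a s ha ih => rw [Finset.sum_insert ha, Finset.prod_insert ha, add, ih]

lemma mul_natCast (c : ℝ≥0∞) (n : ℕ) : negExp (c * n) = negExp c ^ n := by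
  have := sum (Finset.range n) (fun _ => c)
  simpa [mul_comm] using this

lemma iSup {ι : Type*} [Nonempty ι] (f : ι → ℝ≥0∞) : negExp (⨆ i, f i) = ⨅ i, negExp (f i) :=
  antitone.map_ciSup_of_continuousAt continuous.continuousAt

/-- An infinite product written as an infimum of partial products, the form to which monotone
convergence for decreasing sequences applies. -/
lemma tsum (f : ℕ → ℝ≥0∞) :
    negExp (∑' k, f k) = ⨅ n, ∏ k ∈ Finset.range n, negExp (f k) := by
  rw [ENNReal.tsum_eq_iSup_nat, iSup]
  simp_rw [sum]

/-- Every number in `[0, 1]` is of the form `negExp g`. -/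
lemma negLog {v : ℝ≥0∞} (hv : v ≤ 1) : negExp (-(ENNReal.log v)).toENNReal = v := by
  rw [negExp, EReal.coe_toENNReal, neg_neg, ENNReal.exp_log]
  rw [EReal.le_neg, neg_zero, ← ENNReal.log_one]
  exact ENNReal.log_monotone hv

/-- The graph of `negExp` lies above its tangent at `m`. -/
lemma tangent (m : ℝ≥0) (x : ℝ≥0∞) :
    negExp m + negExp m * m ≤ negExp x + negExp m * x := by
  induction x with
  | top =>
    rw [ENNReal.mul_top]
    · simp
    · rw [coe]; simp [Real.exp_pos]
  | coe x =>
    rw [coe, coe, ← ENNReal.ofReal_coe_nnreal, ← ENNReal.ofReal_coe_nnreal,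
      ← ENNReal.ofReal_mul (by positivity), ← ENNReal.ofReal_mul (by positivity),
      ← ENNReal.ofReal_add (by positivity) (by positivity),
      ← ENNReal.ofReal_add (by positivity) (by positivity)]
    apply ENNReal.ofReal_le_ofReal
    -- The inequality 1 + y ≤ e^y at y = m - x, to be multiplied by e^(-m).
    have h1 := Real.add_one_le_exp ((m : ℝ) - x)
    have h2 : Real.exp (-(x : ℝ)) = Real.exp (-m) * Real.exp ((m : ℝ) - x) := by
      rw [← Real.exp_add]; ring_nf
    rw [h2]
    nlinarith [Real.exp_pos (-(m : ℝ))]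

/-- Jensen's inequality for `negExp`. -/
lemma lintegral_le {Ω : Type*} [MeasurableSpace Ω] (P : Measure Ω) [IsProbabilityMeasure P]
    {X : Ω → ℝ≥0∞} (hX : Measurable X) : negExp (∫⁻ ω, X ω ∂P) ≤ ∫⁻ ω, negExp (X ω) ∂P := by
  rcases eq_or_ne (∫⁻ ω, X ω ∂P) ∞ with h | h
  · simp [h]
  lift (∫⁻ ω, X ω ∂P) to ℝ≥0 using h with m hm
  -- Integrating the tangent inequality at the mean m: the linear terms on both sides become equal
  -- and finite, and cancel.
  have h1 := lintegral_mono (μ := P) (fun ω => tangent m (X ω))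
  rw [lintegral_const, lintegral_add_left (by fun_prop), lintegral_const_mul _ hX, ← hm,
    measure_univ, mul_one] at h1
  exact (ENNReal.add_le_add_iff_right (ENNReal.mul_ne_top (ne_top _) ENNReal.coe_ne_top)).1 h1

end negExp

/-! ### Laplace functional of a Poisson point process. -/

section Poisson

lemma toENNReal_pointCount {Ω : Type*} (x : ℕ → Ω → Plane) {B : Set Plane} (ω : Ω) :
    (pointCount x B ω : ℝ≥0∞) = ∑' k, B.indicator (fun _ => (1 : ℝ≥0∞)) (x k ω) := by
  rw [pointCount, ← Measure.count_apply (MeasurableSet.of_discrete),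
    ← lintegral_indicator_one MeasurableSet.of_discrete, lintegral_count]
  rfl

variable {Ω : Type*} [MeasurableSpace Ω]

lemma measurable_pointCount {x : ℕ → Ω → Plane} (hx : ∀ k, Measurable (x k)) {B : Set Plane}
    (hB : MeasurableSet B) : Measurable (pointCount x B) := by
  have h : Measurable fun ω => (pointCount x B ω : ℝ≥0∞) := by
    simp_rw [toENNReal_pointCount]
    exact Measurable.tsum fun k => (measurable_const.indicator hB).comp (hx k)
  refine measurable_to_countable' fun n => ?_
  have : pointCount x B ⁻¹' {n} = (fun ω => (pointCount x B ω : ℝ≥0∞)) ⁻¹' {(n : ℝ≥0∞)} := by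
    ext ω; simp
  rw [this]
  exact h (measurableSet_singleton _)

/-- The Laplace transform of a Poisson random variable. -/
lemma lintegral_negExp_poisson (P : Measure Ω) [IsProbabilityMeasure P] {N : Ω → ℕ∞}
    (hN : Measurable N) (μ : ℝ≥0) (h : ∀ n : ℕ, P {ω | N ω = n} = poissonMeasure μ {n})
    (c : ℝ≥0∞) : ∫⁻ ω, negExp (c * N ω) ∂P = negExp (μ * (1 - negExp c)) := by
  have hmap : P.map N = (poissonMeasure μ).map (Nat.cast : ℕ → ℕ∞) := by
    have : IsProbabilityMeasure (P.map N) := Measure.isProbabilityMeasure_map hN.aemeasurable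
    have hfin : ∀ n : ℕ, P.map N {(n : ℕ∞)} = (poissonMeasure μ).map (Nat.cast : ℕ → ℕ∞) {(n : ℕ∞)} := by
      intro n
      rw [Measure.map_apply hN .of_discrete, Measure.map_apply .of_discrete .of_discrete]
      convert h n using 2 <;> (ext; simp)
    refine Measure.ext_iff_singleton.2 fun n => ?_
    induction n with
    | coe n => exact hfin n
    | top =>
      -- The hypothesis prescribes only the finite atoms; the mass at ⊤ is what remains of total
      -- mass 1.
      have h1 : ({⊤} : Set ℕ∞) = (⋃ n : ℕ, {(n : ℕ∞)})ᶜ := by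
        ext a; induction a <;> simp
      have h2 : ∀ ν : Measure ℕ∞, ν (⋃ n : ℕ, {(n : ℕ∞)}) = ∑' n : ℕ, ν {(n : ℕ∞)} := fun ν =>
        measure_iUnion (fun i j hij => by simpa using hij) fun _ => .of_discrete
      rw [h1, prob_compl_eq_one_sub .of_discrete, prob_compl_eq_one_sub .of_discrete, h2, h2]
      simp_rw [hfin]
  have h3 : ∫⁻ ω, negExp (c * N ω) ∂P = ∫⁻ n : ℕ∞, negExp (c * n) ∂(P.map N) :=
    (lintegral_map (f := fun n : ℕ∞ => negExp (c * n)) .of_discrete hN).symm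
  rw [h3, hmap, lintegral_map .of_discrete .of_discrete, lintegral_countable']
  simp_rw [ENat.toENNReal_coe, negExp.mul_natCast, poissonMeasure_singleton]
  set q := (negExp c).toReal with hq
  have hqc : negExp c = ENNReal.ofReal q := (ENNReal.ofReal_toReal (negExp.ne_top c)).symm
  have hq0 : 0 ≤ q := ENNReal.toReal_nonneg
  have hq1 : q ≤ 1 := ENNReal.toReal_le_of_le_ofReal zero_le_one (by simpa using negExp.le_one c)
  have hsum : HasSum (fun n : ℕ => q ^ n * (Real.exp (-μ) * μ ^ n / n.factorial))
      (Real.exp (-(μ * (1 - q)))) := by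
    have := (NormedSpace.expSeries_div_hasSum_exp (q * μ : ℝ)).mul_left (Real.exp (-μ))
    rw [← Real.exp_eq_exp_ℝ, ← Real.exp_add] at this
    have h5 : -(μ * (1 - q)) = -μ + q * μ := by ring
    rw [h5]
    refine this.congr_fun fun n => ?_
    rw [mul_pow]; ring
  have h4 : ∀ n : ℕ, negExp c ^ n * ENNReal.ofReal (Real.exp (-μ) * μ ^ n / n.factorial) =
      ENNReal.ofReal (q ^ n * (Real.exp (-μ) * μ ^ n / n.factorial)) := fun n => by
    rw [hqc, ← ENNReal.ofReal_pow hq0, ← ENNReal.ofReal_mul (by positivity)]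
  simp_rw [h4]
  rw [← ENNReal.ofReal_tsum_of_nonneg (fun n => by positivity) hsum.summable, hsum.tsum_eq, hqc,
    ← ENNReal.ofReal_one, ← ENNReal.ofReal_sub _ hq0, ← ENNReal.ofReal_coe_nnreal,
    ← ENNReal.ofReal_mul μ.coe_nonneg, negExp.ofReal (mul_nonneg μ.coe_nonneg (sub_nonneg.2 hq1))]

variable {P : Measure Ω} [IsProbabilityMeasure P] {x : ℕ → Ω → Plane} {lam : ℝ≥0}

namespace IsHomogeneousPPP

lemma lintegral_negExp_pointCount (h : IsHomogeneousPPP P x lam) {B : Set Plane}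
    (hB : MeasurableSet B) (hvol : volume B ≠ ∞) (c : ℝ≥0∞) :
    ∫⁻ ω, negExp (c * pointCount x B ω) ∂P = negExp (lam * (volume B * (1 - negExp c))) := by
  rw [lintegral_negExp_poisson P (measurable_pointCount h.measurable_point hB) _
    (h.count_law B hB hvol), ENNReal.coe_mul, ENNReal.coe_toNNReal hvol, mul_assoc]

/-- The Laplace functional of a Poisson process at a simple function. -/
lemma lintegral_negExp_tsum_simpleFunc (h : IsHomogeneousPPP P x lam) (g : SimpleFunc Plane ℝ≥0∞)
    (hg : ∀ c ≠ 0, volume (g ⁻¹' {c}) ≠ ∞) :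
    ∫⁻ ω, negExp (∑' k, g (x k ω)) ∂P = negExp (lam * ∫⁻ y, (1 - negExp (g y))) := by
  -- The value 0 is dropped: its level set may have infinite area, but it contributes nothing to
  -- either side.
  set s := g.range.erase 0 with hs
  have hmeas : ∀ c, MeasurableSet (g ⁻¹' {c}) := fun c => g.measurableSet_preimage _
  have hsum : ∀ ω, ∑' k, g (x k ω) = ∑ c ∈ s, c * pointCount x (g ⁻¹' {c}) ω := by
    intro ω
    simp_rw [toENNReal_pointCount, ← ENNReal.tsum_mul_left]
    rw [← Summable.tsum_finsetSum (fun _ _ => ENNReal.summable)]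
    congr 1
    ext k
    rcases eq_or_ne (g (x k ω)) 0 with h0 | h0
    · rw [h0, Finset.sum_eq_zero]
      intro c hc
      have hc0 : c ≠ 0 := Finset.ne_of_mem_erase hc
      simp [Set.indicator, h0, hc0.symm]
    · rw [Finset.sum_eq_single_of_mem (g (x k ω)) (Finset.mem_erase.2 ⟨h0, g.mem_range_self _⟩)]
      · simp
      · intro c _ hc
        simp [Set.indicator, hc.symm]
  have hindep : iIndepFun (fun c : s => pointCount x (g ⁻¹' {(c : ℝ≥0∞)})) P := by
    have := h.count_indep s.card (fun i => g ⁻¹' {(s.equivFin.symm i : ℝ≥0∞)}) (fun i => hmeas _)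
      (fun i => hg _ (Finset.ne_of_mem_erase (s.equivFin.symm i).2)) (fun i j hij => by
        refine Disjoint.preimage _ (Set.disjoint_singleton.2 fun he => hij ?_)
        exact s.equivFin.symm.injective (Subtype.ext he))
    have h2 := this.precomp (g := s.equivFin) s.equivFin.injective
    simpa using h2
  have hindep' : iIndepFun (fun (c : s) ω => negExp (c * pointCount x (g ⁻¹' {(c : ℝ≥0∞)}) ω)) P :=
    hindep.comp (fun (c : s) (n : ℕ∞) => negExp (c * n)) (fun _ => .of_discrete)
  simp_rw [hsum, negExp.sum]
  simp_rw [← Finset.prod_coe_sort s]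
  rw [lintegral_prod_eq_prod_lintegral_of_indepFun _ _ hindep' (fun c => by
    have := measurable_pointCount h.measurable_point (hmeas c)
    exact (Measurable.of_discrete (f := fun n : ℕ∞ => negExp (c * n))).comp this)]
  simp_rw [h.lintegral_negExp_pointCount (hmeas _) (hg _ (Finset.ne_of_mem_erase (Subtype.prop _)))]
  rw [← negExp.sum, ← Finset.mul_sum,
    Finset.sum_coe_sort s fun c => volume (g ⁻¹' {c}) * (1 - negExp c)]
  congr 2
  have := SimpleFunc.map_lintegral (μ := volume) (fun c => 1 - negExp c) g
  rw [← SimpleFunc.lintegral_eq_lintegral, SimpleFunc.coe_map] at this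
  simp only [Function.comp_apply] at this
  rw [this, hs]
  simp_rw [mul_comm (volume _)]
  refine Finset.sum_erase _ (by simp)

/-- A lower bound for the Laplace functional of a Poisson process. -/
lemma negExp_le_lintegral (h : IsHomogeneousPPP P x lam) {g : Plane → ℝ≥0∞} (hg : Measurable g) :
    negExp (lam * ∫⁻ y, (1 - negExp (g y))) ≤ ∫⁻ ω, negExp (∑' k, g (x k ω)) ∂P := by
  -- Cutting off to balls makes every nonzero level set of the approximants finite in area.
  set G : ℕ → SimpleFunc Plane ℝ≥0∞ := fun n =>
    (SimpleFunc.eapprox g n).restrict (Metric.ball 0 n) with hG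
  have hGval : ∀ n y, G n y = (Metric.ball (0 : Plane) n).indicator (SimpleFunc.eapprox g n) y :=
    fun n y => SimpleFunc.restrict_apply _ measurableSet_ball y
  have hmono : Monotone fun n y => G n y := by
    intro m n hmn y
    simp only [hGval]
    refine (Set.indicator_le_indicator (SimpleFunc.monotone_eapprox g hmn y)).trans
      (Set.indicator_le_indicator_of_subset (Metric.ball_subset_ball (by exact_mod_cast hmn))
        (fun _ => zero_le) _)
  have hle : ∀ n y, G n y ≤ g y := by
    intro n y
    rw [hGval]
    refine (Set.indicator_le_self' (fun _ _ => zero_le) _).trans ?_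
    rw [← SimpleFunc.iSup_eapprox_apply hg y]
    exact le_iSup (fun n => SimpleFunc.eapprox g n y) n
  have hsup : ∀ y, ⨆ n, G n y = g y := by
    intro y
    refine le_antisymm (iSup_le fun n => hle n y) ?_
    rw [← SimpleFunc.iSup_eapprox_apply hg y]
    refine iSup_le fun n => ?_
    obtain ⟨m, hm⟩ := exists_nat_gt ‖y‖
    refine le_iSup_of_le (max n m) ?_
    rw [hGval, Set.indicator_of_mem]
    · exact SimpleFunc.monotone_eapprox g (le_max_left n m) y
    · rw [mem_ball_zero_iff]
      exact hm.trans_le (by exact_mod_cast le_max_right n m)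
  have hsupsum : ∀ ω, ∑' k, g (x k ω) = ⨆ n, ∑' k, G n (x k ω) := by
    intro ω
    simp_rw [← hsup, ← lintegral_count]
    exact lintegral_iSup (fun n => .of_discrete) fun m n hmn k => hmono hmn _
  simp_rw [hsupsum, negExp.iSup]
  -- For each n the exact formula for `G n` already dominates the claimed bound because `G n ≤ g`,
  -- so no limit is taken in the area integral.
  rw [lintegral_iInf]
  · refine le_iInf fun n => ?_
    rw [h.lintegral_negExp_tsum_simpleFunc]
    · refine negExp.antitone (mul_le_mul_right (lintegral_mono fun y => ?_) _)
      exact tsub_le_tsub_left (negExp.antitone (hle n y)) 1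
    · intro c hc
      refine ne_top_of_le_ne_top (measure_ball_lt_top (μ := volume) (x := (0 : Plane)) (r := n)).ne
        (measure_mono fun y hy => ?_)
      by_contra hy'
      rw [Set.mem_preimage, hGval, Set.indicator_of_notMem hy'] at hy
      exact hc hy.symm
  · intro n
    exact negExp.measurable.comp
      (Measurable.tsum fun k => (G n).measurable.comp (h.measurable_point k))
  · intro m n hmn ω
    exact negExp.antitone (ENNReal.tsum_le_tsum fun k => hmono hmn _)
  · exact ((lintegral_mono fun ω => negExp.le_one _).trans_lt (by simp)).ne

end IsHomogeneousPPP

end Poisson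

/-! ### The exponential law of |h|² for h ~ CN(0,1). -/

section ComplexGaussian

lemma stdComplexGaussian_eq_withDensity :
    stdComplexGaussian = volume.withDensity
      (fun z : ℂ => ENNReal.ofReal (Real.exp (-(z.re ^ 2 + z.im ^ 2)) / Real.pi)) := by
  have hv : (1 / 2 : ℝ≥0) ≠ 0 := by norm_num
  have hm : (fun z : ℝ × ℝ => (⟨z.1, z.2⟩ : ℂ)) = Complex.measurableEquivRealProd.symm := rfl
  rw [stdComplexGaussian, gaussianReal_of_var_ne_zero _ hv,
    prod_withDensity (measurable_gaussianPDF _ _) (measurable_gaussianPDF _ _), hm]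
  refine Measure.ext fun s hs => ?_
  rw [MeasurableEquiv.map_apply, withDensity_apply _ (by measurability), withDensity_apply _ hs,
    ← Complex.volume_preserving_equiv_real_prod.symm.setLIntegral_comp_preimage_emb
      (MeasurableEquiv.measurableEmbedding _)]
  refine lintegral_congr fun z => ?_
  rw [gaussianPDF, gaussianPDF, ← ENNReal.ofReal_mul (gaussianPDFReal_nonneg _ _ _),
    gaussianPDFReal, gaussianPDFReal]
  congr 1
  rw [mul_mul_mul_comm, ← Real.exp_add, ← mul_inv, Real.mul_self_sqrt (by positivity), div_eq_inv_mul, mul_comm]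
  have h1 : (Complex.measurableEquivRealProd.symm z).re = z.1 := rfl
  have h2 : (Complex.measurableEquivRealProd.symm z).im = z.2 := rfl
  rw [h1, h2]
  congr 2
  · push_cast; ring
  · push_cast; ring

/-- If `z` has law `CN(0,1)`, then `‖z‖ ^ 2` is exponentially distributed. -/
lemma lintegral_stdComplexGaussian {f : ℝ≥0∞ → ℝ≥0∞} (hf : Measurable f) :
    ∫⁻ z, f (‖z‖ₑ ^ 2) ∂stdComplexGaussian =
      ∫⁻ u in Set.Ioi (0 : ℝ), ENNReal.ofReal (Real.exp (-u)) * f (ENNReal.ofReal u) := by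
  rw [stdComplexGaussian_eq_withDensity, lintegral_withDensity_eq_lintegral_mul _ (by fun_prop)
    (by fun_prop), ← Complex.lintegral_comp_polarCoord_symm]
  have h1 : ∀ p ∈ polarCoord.target, ENNReal.ofReal p.1 • (((fun z : ℂ =>
      ENNReal.ofReal (Real.exp (-(z.re ^ 2 + z.im ^ 2)) / Real.pi)) * (fun z => f (‖z‖ₑ ^ 2)) :
        ℂ → ℝ≥0∞)) (Complex.polarCoord.symm p) =
      ENNReal.ofReal (p.1 * (Real.exp (-p.1 ^ 2) / Real.pi)) * f (ENNReal.ofReal (p.1 ^ 2)) := by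
    intro p hp
    have hp0 : 0 < p.1 := hp.1
    have h2 : ‖Complex.polarCoord.symm p‖ = p.1 := by
      rw [Complex.norm_polarCoord_symm, abs_of_pos hp0]
    rw [smul_eq_mul, Pi.mul_apply, ← mul_assoc, ← ENNReal.ofReal_mul hp0.le, ← ofReal_norm, h2,
      ENNReal.ofReal_pow hp0.le]
    congr 5
    rw [← h2, ← Complex.normSq_eq_norm_sq, Complex.normSq_apply]; ring
  rw [setLIntegral_congr_fun polarCoord.open_target.measurableSet h1]
  rw [show polarCoord.target = Set.Ioi (0 : ℝ) ×ˢ Set.Ioo (-Real.pi) Real.pi from rfl,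
    Measure.volume_eq_prod, ← Measure.prod_restrict,
    lintegral_prod _ (by fun_prop)]
  simp only [lintegral_const, Measure.restrict_apply MeasurableSet.univ, Set.univ_inter,
    Real.volume_Ioo]
  -- Substitution u = r²: the angular factor 2π against the density's 1/π leaves 2r dr = du.
  have himg : (fun r : ℝ => r ^ 2) '' Set.Ioi 0 = Set.Ioi 0 := by
    ext u
    constructor
    · rintro ⟨r, hr, rfl⟩
      exact pow_pos (Set.mem_Ioi.1 hr) 2
    · intro hu
      exact ⟨√u, Real.sqrt_pos.2 hu, Real.sq_sqrt (le_of_lt hu)⟩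
  conv_rhs => rw [← himg]
  rw [lintegral_image_eq_lintegral_abs_deriv_mul (f' := fun r => 2 * r) measurableSet_Ioi]
  · refine setLIntegral_congr_fun measurableSet_Ioi fun r (hr : 0 < r) => ?_
    rw [mul_right_comm, ← mul_assoc, ← ENNReal.ofReal_mul (by positivity),
      ← ENNReal.ofReal_mul (by positivity), abs_of_pos (by positivity)]
    congr 2
    field_simp
    ring
  · intro r _
    simpa using (hasDerivAt_pow 2 r).hasDerivWithinAt
  · intro a (ha : 0 < a) b (hb : 0 < b) hab
    exact (pow_left_inj₀ ha.le hb.le two_ne_zero).1 hab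

instance : IsProbabilityMeasure stdComplexGaussian := by
  rw [stdComplexGaussian]
  refine Measure.isProbabilityMeasure_map ?_
  exact (Complex.measurableEquivRealProd.symm.measurable).aemeasurable

lemma stdComplexGaussian_le_enorm_sq (t : ℝ≥0∞) :
    stdComplexGaussian {z | t ≤ ‖z‖ₑ ^ 2} = negExp t := by
  have h := lintegral_stdComplexGaussian (f := (Set.Ici t).indicator 1)
    (measurable_one.indicator measurableSet_Ici)
  have h1 : (fun z : ℂ => (Set.Ici t).indicator (1 : ℝ≥0∞ → ℝ≥0∞) (‖z‖ₑ ^ 2)) =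
      {z : ℂ | t ≤ ‖z‖ₑ ^ 2}.indicator 1 := rfl
  rw [h1, lintegral_indicator_one (measurableSet_le measurable_const (by fun_prop))] at h
  rw [h]
  induction t with
  | top => simp [Set.indicator]
  | coe t =>
    have h2 : ∀ u : ℝ, ENNReal.ofReal (Real.exp (-u)) *
        (Set.Ici (t : ℝ≥0∞)).indicator 1 (ENNReal.ofReal u) =
        {u : ℝ | (t : ℝ≥0∞) ≤ ENNReal.ofReal u}.indicator (fun u => ENNReal.ofReal (Real.exp (-u))) u := by
      intro u
      by_cases hu : (t : ℝ≥0∞) ≤ ENNReal.ofReal u <;> simp [hu]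
    simp_rw [h2]
    rw [setLIntegral_indicator (measurableSet_le measurable_const (by fun_prop))]
    have h3 : ({u : ℝ | (t : ℝ≥0∞) ≤ ENNReal.ofReal u} ∩ Set.Ioi 0 : Set ℝ) =ᵐ[volume]
        Set.Ioi (t : ℝ) := by
      have h4 : ({u : ℝ | (t : ℝ≥0∞) ≤ ENNReal.ofReal u} ∩ Set.Ioi 0 : Set ℝ) =
          Set.Ici (t : ℝ) ∩ Set.Ioi 0 := by
        ext u
        simp only [Set.mem_inter_iff, Set.mem_ofPred_eq, Set.mem_Ioi, Set.mem_Ici]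
        refine and_congr_left fun hu => ?_
        rw [← ENNReal.ofReal_coe_nnreal, ENNReal.ofReal_le_ofReal_iff hu.le]
      · rw [h4]
        have := (Ioi_ae_eq_Ici (μ := volume) (a := (t : ℝ))).symm.inter
          (Filter.EventuallyEq.refl (ae volume) (Set.Ioi (0 : ℝ)))
        rwa [Set.Ioi_inter_Ioi, max_eq_left t.coe_nonneg] at this
    rw [setLIntegral_congr h3, negExp.coe, ← integral_exp_neg_Ioi,
      ofReal_integral_eq_lintegral_ofReal (integrableOn_exp_neg_Ioi _)
        (Filter.Eventually.of_forall fun _ => (Real.exp_pos _).le)]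

lemma lintegral_stdComplexGaussian_rpow {s : ℝ} (hs : -1 < s) :
    ∫⁻ z, (‖z‖ₑ ^ 2) ^ s ∂stdComplexGaussian = ENNReal.ofReal (Real.Gamma (1 + s)) := by
  rw [lintegral_stdComplexGaussian (f := fun t => t ^ s) (by fun_prop),
    Real.Gamma_eq_integral (by linarith), ofReal_integral_eq_lintegral_ofReal
      (Real.GammaIntegral_convergent (by linarith))]
  · refine setLIntegral_congr_fun measurableSet_Ioi fun u (hu : 0 < u) => ?_
    rw [ENNReal.ofReal_rpow_of_pos hu, ← ENNReal.ofReal_mul (Real.exp_pos _).le, add_sub_cancel_left]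
  · refine (ae_restrict_iff' measurableSet_Ioi).2 (Filter.Eventually.of_forall fun u hu => ?_)
    have : (0 : ℝ) < u := hu
    simp only [Pi.zero_apply]
    positivity

lemma stdComplexGaussian_singleton_zero : stdComplexGaussian {0} = 0 := by
  rw [stdComplexGaussian_eq_withDensity]
  exact withDensity_absolutelyContinuous _ _ (by simp)

end ComplexGaussian

/-! ### The path-loss integral over the plane. -/

section PathLoss

/-- Reading 1 - e^(-t) as the distribution function of |z|² lets Fubini turn the path-loss integral
into an average of disc areas. -/
lemma one_sub_negExp (t : ℝ≥0∞) :
    1 - negExp t = stdComplexGaussian {z | ‖z‖ₑ ^ 2 < t} := by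
  rw [← stdComplexGaussian_le_enorm_sq, ← prob_compl_eq_one_sub
    (measurableSet_le measurable_const (by fun_prop))]
  congr 1
  ext z
  simp

lemma volume_enorm_lt {ρ : ℝ≥0∞} (hρ : ρ ≠ ∞) :
    volume {x : Plane | ‖x‖ₑ < ρ} = ρ ^ 2 * ENNReal.ofReal Real.pi := by
  have h : {x : Plane | ‖x‖ₑ < ρ} = Metric.ball 0 ρ.toReal := by
    ext x
    rw [Set.mem_ofPred_eq, mem_ball_zero_iff, ← ofReal_norm,
      ENNReal.ofReal_lt_iff_lt_toReal (norm_nonneg _) hρ]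
  rw [h, EuclideanSpace.volume_ball_fin_two, ENNReal.ofReal_toReal hρ]

/-- The set is the open disc of radius (c / H)^(1/α); the case c = 0 is the empty disc. -/
lemma volume_lt_mul_enorm_rpow {α : ℝ} (hα : 0 < α) {c H : ℝ≥0∞} (hc : c ≠ ∞) (hH0 : H ≠ 0)
    (hH : H ≠ ∞) :
    volume {x : Plane | H < c * ‖x‖ₑ ^ (-α)} =
      ENNReal.ofReal Real.pi * c ^ (2 / α) * H ^ (-(2 / α)) := by
  have h : {x : Plane | H < c * ‖x‖ₑ ^ (-α)} = {x : Plane | ‖x‖ₑ < (c / H) ^ α⁻¹} := by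
    ext x
    have hx : ‖x‖ₑ ^ α ≠ ∞ := ENNReal.rpow_ne_top_of_nonneg hα.le enorm_ne_top
    rw [Set.mem_ofPred_eq, Set.mem_ofPred_eq, ENNReal.rpow_neg, ← div_eq_mul_inv,
      ENNReal.lt_div_iff_mul_lt (.inr hH) (.inl hx), ENNReal.lt_rpow_inv_iff hα,
      ENNReal.lt_div_iff_mul_lt (.inl hH0) (.inl hH), mul_comm]
  have hcH : c / H ≠ ∞ := ENNReal.div_ne_top hc hH0
  rw [h, volume_enorm_lt (ENNReal.rpow_ne_top_of_nonneg (by positivity) hcH), ← ENNReal.rpow_two,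
    ← ENNReal.rpow_mul, ENNReal.rpow_neg, ← ENNReal.inv_rpow, mul_assoc,
    ← ENNReal.mul_rpow_of_nonneg _ _ (by positivity), ← div_eq_mul_inv, mul_comm]
  ring_nf

/-- After Fubini with an auxiliary CN(0,1) variable z, the disc areas average to a moment of |z|² of
order -2/α. This moment is Γ(1 - 2/α), finite because α > 2. -/
lemma lintegral_one_sub_negExp {α : ℝ} (hα : 2 < α) {c : ℝ≥0∞} (hc : c ≠ ∞) :
    ∫⁻ x : Plane, (1 - negExp (c * ‖x‖ₑ ^ (-α))) =
      ENNReal.ofReal (Real.pi * Real.Gamma (1 - 2 / α)) * c ^ (2 / α) := by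
  have hα0 : 0 < α := by linarith
  have ht : 2 / α < 1 := by rw [div_lt_one hα0]; exact hα
  have hmeas : MeasurableSet {q : Plane × ℂ | ‖q.2‖ₑ ^ 2 < c * ‖q.1‖ₑ ^ (-α)} :=
    measurableSet_lt (by fun_prop) (by fun_prop)
  have h1 : ∀ x : Plane, 1 - negExp (c * ‖x‖ₑ ^ (-α)) = stdComplexGaussian
      (Prod.mk x ⁻¹' {q : Plane × ℂ | ‖q.2‖ₑ ^ 2 < c * ‖q.1‖ₑ ^ (-α)}) :=
    fun x => one_sub_negExp _
  have h0 : ∀ᵐ z ∂stdComplexGaussian, z ≠ 0 :=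
    compl_mem_ae_iff.2 stdComplexGaussian_singleton_zero
  simp_rw [h1]
  rw [← Measure.prod_apply hmeas, Measure.prod_apply_symm hmeas]
  have h2 : ∀ᵐ z ∂stdComplexGaussian, volume
      ((fun x : Plane => (x, z)) ⁻¹' {q : Plane × ℂ | ‖q.2‖ₑ ^ 2 < c * ‖q.1‖ₑ ^ (-α)}) =
      ENNReal.ofReal Real.pi * c ^ (2 / α) * (‖z‖ₑ ^ 2) ^ (-(2 / α)) := by
    filter_upwards [h0] with z hz
    exact volume_lt_mul_enorm_rpow (H := ‖z‖ₑ ^ 2) hα0 hc (by simpa using hz) (by simp)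
  rw [lintegral_congr_ae h2, lintegral_const_mul _ (by fun_prop),
    lintegral_stdComplexGaussian_rpow (by linarith), ENNReal.ofReal_mul Real.pi_pos.le,
    ← sub_eq_add_neg]
  ring

/-- The integrated probability generating function of the marked interferers. -/
lemma lintegral_one_sub_lintegral_negExp {Ω : Type*} [MeasurableSpace Ω] (P : Measure Ω)
    [IsProbabilityMeasure P] {α : ℝ} (hα : 2 < α) {s : ℝ≥0∞} (hs : s ≠ ∞) {M : Ω → ℝ≥0∞}
    (hM : Measurable M) (hM' : ∀ ω, M ω ≠ ∞) :
    ∫⁻ x : Plane, (1 - ∫⁻ ω, negExp (s * (M ω * ‖x‖ₑ ^ (-α))) ∂P) =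
      ENNReal.ofReal (Real.pi * Real.Gamma (1 - 2 / α)) * s ^ (2 / α) *
        ∫⁻ ω, M ω ^ (2 / α) ∂P := by
  have hα0 : 0 < α := by linarith
  have h1 : ∀ x : Plane, 1 - ∫⁻ ω, negExp (s * (M ω * ‖x‖ₑ ^ (-α))) ∂P =
      ∫⁻ ω, (1 - negExp (s * M ω * ‖x‖ₑ ^ (-α))) ∂P := by
    intro x
    simp_rw [mul_assoc s]
    rw [lintegral_sub (by fun_prop)
      ((lintegral_mono fun ω => negExp.le_one _).trans_lt (by simp)).ne
      (Filter.Eventually.of_forall fun ω => negExp.le_one _)]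
    simp
  simp_rw [h1]
  rw [lintegral_lintegral_swap (by fun_prop)]
  simp_rw [lintegral_one_sub_negExp hα (ENNReal.mul_ne_top hs (hM' _)),
    ENNReal.mul_rpow_of_nonneg _ _ (show (0 : ℝ) ≤ 2 / α by positivity), ← mul_assoc]
  rw [lintegral_const_mul _ (by fun_prop)]

/-- Euler's reflection formula with Γ(1 + t) = t Γ(t); this is where sinc enters. -/
lemma pi_mul_Gamma_mul_Gamma {t : ℝ} (h0 : 0 < t) :
    Real.pi * Real.Gamma (1 - t) * Real.Gamma (1 + t) = Real.pi / nsinc t := by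
  rw [nsinc, Real.sinc_of_ne_zero (by positivity), add_comm 1 t, Real.Gamma_add_one h0.ne',
    mul_assoc, mul_comm (Real.Gamma (1 - t)), mul_assoc, Real.Gamma_mul_Gamma_one_sub,
    div_div_eq_mul_div]
  ring

end PathLoss

/-! ### Shot noise with independent marks. -/

section Interference

variable {Ω : Type*} [MeasurableSpace Ω] {P : Measure Ω} [IsProbabilityMeasure P]

lemma ProbabilityTheory.IndepFun.lintegral_comp_prodMk {β γ : Type*} [MeasurableSpace β]
    [MeasurableSpace γ] {X : Ω → β} {Y : Ω → γ} (h : IndepFun X Y P) (hX : Measurable X)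
    (hY : Measurable Y) {F : β × γ → ℝ≥0∞} (hF : Measurable F) :
    ∫⁻ ω, F (X ω, Y ω) ∂P = ∫⁻ ω, ∫⁻ ω', F (X ω, Y ω') ∂P ∂P := by
  have : IsProbabilityMeasure (P.map Y) := Measure.isProbabilityMeasure_map hY.aemeasurable
  rw [← lintegral_map hF (hX.prodMk hY),
    (indepFun_iff_map_prod_eq_prod_map_map hX.aemeasurable hY.aemeasurable).1 h,
    lintegral_prod _ hF.aemeasurable, lintegral_map hF.lintegral_prod_right' hX]
  refine lintegral_congr fun ω => ?_
  rw [lintegral_map (by fun_prop) hY]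

lemma lintegral_negExp_tsum_of_iIndepFun {Y : ℕ → Ω → ℝ≥0∞} (hY : ∀ k, Measurable (Y k))
    (hi : iIndepFun Y P) :
    ∫⁻ ω, negExp (∑' k, Y k ω) ∂P = ⨅ n, ∏ k ∈ Finset.range n, ∫⁻ ω, negExp (Y k ω) ∂P := by
  simp_rw [negExp.tsum]
  rw [lintegral_iInf]
  · congr 1
    ext n
    exact lintegral_prod_eq_prod_lintegral_of_indepFun _ _
      (hi.comp (fun _ => negExp) fun _ => negExp.measurable)
      fun k => negExp.measurable.comp (hY k)
  · intro n
    exact Finset.measurable_prod _ fun k _ => negExp.measurable.comp (hY k)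
  · intro m n hmn ω
    simp only [← negExp.sum]
    exact negExp.antitone (Finset.sum_le_sum_of_subset (by simpa using hmn))
  · simp

/-- Lower bound for the Laplace transform of the shot noise of a Poisson process with
independent, identically distributed marks. -/
lemma negExp_le_lintegral_shotNoise {x : ℕ → Ω → Plane} {lam : ℝ≥0}
    (hx : IsHomogeneousPPP P x lam) {M : ℕ → Ω → ℝ≥0∞} (hM : ∀ k, Measurable (M k))
    (hMi : iIndepFun M P) (hMx : IndepFun (fun ω k => x k ω) (fun ω k => M k ω) P)
    (hMd : ∀ k, P.map (M k) = P.map (M 0)) {ρ : Plane → ℝ≥0∞} (hρ : Measurable ρ) :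
    negExp (lam * ∫⁻ y, (1 - ∫⁻ ω, negExp (M 0 ω * ρ y) ∂P)) ≤
      ∫⁻ ω, negExp (∑' k, M k ω * ρ (x k ω)) ∂P := by
  have hxm : Measurable fun ω k => x k ω := measurable_pi_lambda _ hx.measurable_point
  have hMm : Measurable fun ω k => M k ω := measurable_pi_lambda _ hM
  set v : Plane → ℝ≥0∞ := fun y => ∫⁻ ω, negExp (M 0 ω * ρ y) ∂P with hv
  have hM0 := hM 0
  have hvm : Measurable v := by
    refine Measurable.lintegral_prod_right' (f := fun q : Plane × Ω => negExp (M 0 q.2 * ρ q.1)) ?_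
    fun_prop
  have hv1 : ∀ y, v y ≤ 1 := fun y =>
    (lintegral_mono fun ω => negExp.le_one _).trans (by simp)
  -- With e^(-g) = v, averaging out the marks leaves the Laplace functional of the unmarked process
  -- at g. Where v vanishes, g = ∞.
  set g : Plane → ℝ≥0∞ := fun y => (-(ENNReal.log (v y))).toENNReal with hg
  have hgm : Measurable g := hvm.ennreal_log.neg.ereal_toENNReal
  have hgv : ∀ y, negExp (g y) = v y := fun y => negExp.negLog (hv1 y)
  have hvk : ∀ k y, ∫⁻ ω, negExp (M k ω * ρ y) ∂P = v y := by
    intro k y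
    have hf : Measurable fun m : ℝ≥0∞ => negExp (m * ρ y) := by fun_prop
    rw [hv, ← lintegral_map hf (hM k), hMd k, lintegral_map hf (hM 0)]
  have hF : Measurable fun q : (ℕ → Plane) × (ℕ → ℝ≥0∞) => negExp (∑' k, q.2 k * ρ (q.1 k)) := by
    fun_prop
  have h1 : ∫⁻ ω, negExp (∑' k, M k ω * ρ (x k ω)) ∂P =
      ∫⁻ ω, negExp (∑' k, g (x k ω)) ∂P := by
    -- Freeze the points; the marks are then averaged factor by factor.
    rw [hMx.lintegral_comp_prodMk hxm hMm hF]
    refine lintegral_congr fun ω => ?_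
    rw [lintegral_negExp_tsum_of_iIndepFun (Y := fun k ω' => M k ω' * ρ (x k ω)) (fun k => by
        have := hM k; fun_prop)
        (hMi.comp (fun k m => m * ρ (x k ω)) fun k => by fun_prop), negExp.tsum]
    simp_rw [hvk, hgv]
  rw [h1]
  have h3 := hx.negExp_le_lintegral hgm
  simpa only [hgv] using h3

end Interference

/-! ### Grouping of independent σ-algebras, and moments of the uniform law on a disc. -/

section Auxiliary

lemma ProbabilityTheory.iIndep.iSup_of_pairwise_disjoint {Ω ι κ : Type*}
    {m : ι → MeasurableSpace Ω} {mΩ : MeasurableSpace Ω} {P : Measure Ω} [IsProbabilityMeasure P]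
    (hm : ∀ i, m i ≤ mΩ) (h : iIndep m P) {S : κ → Set ι}
    (hS : Pairwise fun a b => Disjoint (S a) (S b)) :
    iIndep (fun a => ⨆ i ∈ S a, m i) P := by
  classical
  rw [iIndep_iff]
  intro s f hf
  induction s using Finset.induction_on with
  | empty => simp
  | insert a s ha ih =>
    have hind := indep_iSup_of_disjoint hm h (S := S a) (T := ⋃ b ∈ s, S b)
      (Set.disjoint_iUnion₂_right.2 fun b hb => hS fun hab => ha (hab ▸ hb))
    rw [Finset.set_biInter_insert, Finset.prod_insert ha,
      ← ih fun i hi => hf i (Finset.mem_insert_of_mem hi)]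
    refine (Indep_iff _ _ _).1 hind _ _ (hf a (Finset.mem_insert_self a s)) ?_
    refine Finset.measurableSet_biInter s fun b hb => ?_
    refine MeasurableSpace.le_def.1 ?_ _ (hf b (Finset.mem_insert_of_mem hb))
    exact biSup_mono fun i hi => Set.mem_biUnion hb hi

/-- Monotonicity of L^p norms on a probability space, between the exponents t and 1. -/
lemma lintegral_rpow_le_rpow_lintegral {Ω : Type*} [MeasurableSpace Ω] {P : Measure Ω}
    [IsProbabilityMeasure P] {X : Ω → ℝ≥0∞} (hX : Measurable X) {t : ℝ} (h0 : 0 < t) (h1 : t ≤ 1) :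
    ∫⁻ ω, X ω ^ t ∂P ≤ (∫⁻ ω, X ω ∂P) ^ t := by
  have h := eLpNorm'_le_eLpNorm'_of_exponent_le h0 h1 P hX.aestronglyMeasurable
  simp only [eLpNorm', enorm_eq_self, ENNReal.rpow_one, div_one] at h
  rwa [one_div, ENNReal.rpow_inv_le_iff h0] at h

lemma setLIntegral_closedBall_enorm_rpow {α R : ℝ} (hα : 0 < α) (hR : 0 < R) :
    ∫⁻ x in Metric.closedBall (0 : Plane) R, ‖x‖ₑ ^ α =
      ENNReal.ofReal (2 * Real.pi * (R ^ (α + 2) / (α + 2))) := by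
  have hc : Continuous fun x : Plane => ‖x‖ ^ α := continuous_norm.rpow_const fun _ => .inr hα.le
  have h1 : ∀ x : Plane, ‖x‖ₑ ^ α = ENNReal.ofReal (‖x‖ ^ α) := fun x => by
    rw [← ofReal_norm, ENNReal.ofReal_rpow_of_nonneg (norm_nonneg _) hα.le]
  simp_rw [h1]
  rw [← ofReal_integral_eq_lintegral_ofReal
    (hc.continuousOn.integrableOn_compact (isCompact_closedBall 0 R))
    (Filter.Eventually.of_forall fun x => by positivity)]
  congr 1
  have h2 : ∀ x : Plane, (Metric.closedBall (0 : Plane) R).indicator (fun x => ‖x‖ ^ α) x =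
      (Set.Iic R).indicator (fun y => y ^ α) ‖x‖ := by
    intro x
    by_cases hx : ‖x‖ ≤ R <;> simp [Set.indicator, hx]
  rw [← integral_indicator Metric.isClosed_closedBall.measurableSet]
  simp_rw [h2]
  rw [integral_fun_norm_addHaar volume, finrank_euclideanSpace_fin, Measure.real,
    EuclideanSpace.volume_ball_fin_two]
  have h3 : ∀ y : ℝ, y ^ (2 - 1) • (Set.Iic R).indicator (fun y => y ^ α) y =
      (Set.Iic R).indicator (fun y => y * y ^ α) y := by
    intro y
    by_cases hy : y ≤ R <;> simp [Set.indicator, hy]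
  simp_rw [h3]
  rw [setIntegral_indicator measurableSet_Iic, Set.Ioi_inter_Iic]
  have h4 : ∫ y in Set.Ioc 0 R, y * y ^ α = R ^ (α + 2) / (α + 2) := by
    rw [setIntegral_congr_fun (g := fun y => y ^ (α + 1)) measurableSet_Ioc,
      ← intervalIntegral.integral_of_le hR.le, integral_rpow (.inl (by linarith)),
      Real.zero_rpow (by linarith)]
    · ring_nf
    · intro y hy
      change y * y ^ α = y ^ (α + 1)
      rw [Real.rpow_add_one hy.1.ne', mul_comm]
  rw [h4]
  simp [Real.pi_pos.le]
  ring

variable {Ω : Type*} [MeasurableSpace Ω] {P : Measure Ω}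

lemma lintegral_enorm_rpow_of_isUniform {X : Ω → Plane} (hX : Measurable X) {R : ℝ} (hR : 0 < R)
    (hu : pdf.IsUniform X (Metric.closedBall 0 R) P volume) {α : ℝ} (hα : 0 < α) :
    ∫⁻ ω, ‖X ω‖ₑ ^ α ∂P = ENNReal.ofReal (2 / (2 + α) * R ^ α) := by
  have h : ∫⁻ ω, ‖X ω‖ₑ ^ α ∂P = ∫⁻ x, ‖x‖ₑ ^ α ∂(P.map X) :=
    (lintegral_map (f := fun x : Plane => ‖x‖ₑ ^ α) (by fun_prop) hX).symm
  rw [h, hu, ProbabilityTheory.cond, lintegral_smul_measure, setLIntegral_closedBall_enorm_rpow hα hR,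
    EuclideanSpace.volume_closedBall_fin_two, ← ENNReal.ofReal_pow hR.le,
    ← ENNReal.ofReal_mul (by positivity), ← ENNReal.ofReal_inv_of_pos (by positivity), smul_eq_mul,
    ← ENNReal.ofReal_mul (by positivity), Real.rpow_add hR, Real.rpow_two]
  congr 1
  field_simp
  ring

lemma ae_ne_zero_of_isUniform {X : Ω → Plane} (hX : Measurable X) {s : Set Plane}
    (hu : pdf.IsUniform X s P volume) : ∀ᵐ ω ∂P, X ω ≠ 0 := by
  have h : P.map X {0} = 0 := hu.absolutelyContinuous (by simp)
  rw [Measure.map_apply hX (measurableSet_singleton 0)] at h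
  exact compl_mem_ae_iff.2 h

end Auxiliary

/-! ### The uplink model: coverage, conditioning and the final estimate. -/

section Model

lemma measurable_mul_enorm_sq {Ω : Type*} {mΩ : MeasurableSpace Ω} {p : Ω → ℝ≥0} {h : Ω → ℂ}
    (hp : Measurable p) (hh : Measurable h) :
    Measurable fun ω => (p ω : ℝ≥0∞) * ‖h ω‖ₑ ^ 2 := by
  fun_prop

lemma measurable_mul_enorm_sq_pi {Ω : Type*} {mΩ : MeasurableSpace Ω} {p : ℕ → Ω → ℝ≥0}
    {h : ℕ → Ω → ℂ} (hp : ∀ k, Measurable (p k)) (hh : ∀ k, Measurable (h k)) :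
    Measurable fun ω k => (p k ω : ℝ≥0∞) * ‖h k ω‖ₑ ^ 2 :=
  measurable_pi_lambda _ fun k => measurable_mul_enorm_sq (hp k) (hh k)

lemma measurable_const_mul_rpow_mul_inv {Ω : Type*} {mΩ : MeasurableSpace Ω} {x : Ω → Plane}
    {p : Ω → ℝ≥0} (hx : Measurable x) (hp : Measurable p) (c : ℝ≥0∞) (α : ℝ) :
    Measurable fun ω => c * (‖x ω‖ₑ ^ α * (p ω : ℝ≥0∞)⁻¹) := by
  fun_prop

namespace UplinkNetwork

lemma measurable_interference {Ω : Type*} {mΩ : MeasurableSpace Ω} {N : UplinkNetwork Ω}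
    (hp : ∀ k, Measurable (N.power k)) (hh : ∀ k, Measurable (N.fading k))
    (hx : ∀ k, Measurable (N.point k)) (α : ℝ) : Measurable (N.interference α) := by
  unfold interference
  fun_prop

variable {Ω : Type*} (N : UplinkNetwork Ω) {S : Set Source}

lemma measurable_user_iSup (h : Source.user ∈ S) :
    Measurable[⨆ i ∈ S, N.sigmaAlgebra i] N.user :=
  (comap_measurable N.user).mono (le_iSup₂_of_le Source.user h le_rfl) le_rfl

lemma measurable_userPower_iSup (h : Source.userPower ∈ S) :
    Measurable[⨆ i ∈ S, N.sigmaAlgebra i] N.userPower :=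
  (comap_measurable N.userPower).mono (le_iSup₂_of_le Source.userPower h le_rfl) le_rfl

lemma measurable_points_iSup (h : Source.points ∈ S) :
    Measurable[⨆ i ∈ S, N.sigmaAlgebra i] (fun ω k => N.point k ω) :=
  (comap_measurable fun ω k => N.point k ω).mono (le_iSup₂_of_le Source.points h le_rfl) le_rfl

lemma measurable_power_iSup {k : ℕ} (h : Source.power k ∈ S) :
    Measurable[⨆ i ∈ S, N.sigmaAlgebra i] (N.power k) :=
  (comap_measurable (N.power k)).mono (le_iSup₂_of_le (Source.power k) h le_rfl) le_rfl

lemma measurable_fading_iSup {k : ℕ} (h : Source.fading k ∈ S) :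
    Measurable[⨆ i ∈ S, N.sigmaAlgebra i] (N.fading k) :=
  (comap_measurable (N.fading k)).mono (le_iSup₂_of_le (Source.fading k) h le_rfl) le_rfl

lemma measurable_interference_iSup (h₁ : Source.points ∈ S) (h₂ : ∀ k, Source.power k ∈ S)
    (h₃ : ∀ k, Source.fading k ∈ S) (α : ℝ) :
    Measurable[⨆ i ∈ S, N.sigmaAlgebra i] (N.interference α) :=
  measurable_interference (fun k => N.measurable_power_iSup (h₂ k))
    (fun k => N.measurable_fading_iSup (h₃ k))
    (fun k => (measurable_pi_apply k).comp (N.measurable_points_iSup h₁)) α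

/-- The nonvanishing hypotheses make the signal neither 0 nor ∞, so the quotient can be cleared even
when the denominator is 0 or ∞. -/
lemma le_sinr_of_le {Ω : Type*} {N : UplinkNetwork Ω} {α : ℝ} {noise β₀ : ℝ≥0} {ω : Ω} (hu : N.user ω ≠ 0)
    (hp : N.userPower ω ≠ 0) (hf : N.userFading ω ≠ 0)
    (h : β₀ * (‖N.user ω‖ₑ ^ α * (N.userPower ω : ℝ≥0∞)⁻¹) * (N.interference α ω + noise) ≤
      ‖N.userFading ω‖ₑ ^ 2) : (β₀ : ℝ≥0∞) ≤ N.sinr α noise ω := by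
  have hu' : ‖N.user ω‖ₑ ≠ 0 := by simpa using hu
  have hp' : (N.userPower ω : ℝ≥0∞) ≠ 0 := by simpa using hp
  have hD0 : ‖N.user ω‖ₑ ^ α ≠ 0 := (ENNReal.rpow_pos (pos_iff_ne_zero.2 hu') enorm_ne_top).ne'
  have hD : ‖N.user ω‖ₑ ^ α ≠ ∞ := ENNReal.rpow_ne_top_of_ne_zero hu' enorm_ne_top
  have hs : N.signal α ω = ‖N.userFading ω‖ₑ ^ 2 * (N.userPower ω * (‖N.user ω‖ₑ ^ α)⁻¹) := by
    rw [signal, ENNReal.rpow_neg]; ring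
  have hs0 : N.signal α ω ≠ 0 := by
    rw [hs]
    exact mul_ne_zero (by simpa using hf) (mul_ne_zero hp' (ENNReal.inv_ne_zero.2 hD))
  have hst : N.signal α ω ≠ ∞ := by
    rw [hs]
    exact ENNReal.mul_ne_top (by simp)
      (ENNReal.mul_ne_top ENNReal.coe_ne_top (ENNReal.inv_ne_top.2 hD0))
  rw [sinr, ENNReal.le_div_iff_mul_le (.inr hs0) (.inr hst), hs]
  refine le_trans (le_of_eq ?_) (mul_le_mul_left h _)
  have h1 : (N.userPower ω : ℝ≥0∞)⁻¹ * N.userPower ω = 1 :=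
    ENNReal.inv_mul_cancel hp' ENNReal.coe_ne_top
  have h2 : ‖N.user ω‖ₑ ^ α * (‖N.user ω‖ₑ ^ α)⁻¹ = 1 := ENNReal.mul_inv_cancel hD0 hD
  calc (β₀ : ℝ≥0∞) * (N.interference α ω + noise)
      = β₀ * (N.interference α ω + noise) * ((N.userPower ω : ℝ≥0∞)⁻¹ * N.userPower ω) *
        (‖N.user ω‖ₑ ^ α * (‖N.user ω‖ₑ ^ α)⁻¹) := by rw [h1, h2, mul_one, mul_one]
    _ = _ := by ring

variable {N} [MeasurableSpace Ω] {P : Measure Ω} {lam : ℝ≥0} {R : ℝ}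

namespace IsModel

lemma sigmaAlgebra_le (hN : N.IsModel P lam R) (i : Source) :
    N.sigmaAlgebra i ≤ ‹MeasurableSpace Ω› := by
  cases i with
  | user => exact hN.measurable_user.comap_le
  | userPower => exact hN.measurable_userPower.comap_le
  | userFading => exact hN.measurable_userFading.comap_le
  | points => exact (measurable_pi_lambda _ hN.points_poisson.measurable_point).comap_le
  | power k => exact (hN.measurable_power k).comap_le
  | fading k => exact (hN.measurable_fading k).comap_le

lemma indepFun_of_disjoint (hN : N.IsModel P lam R) {S T : Set Source} (hST : Disjoint S T)
    {β γ : Type*} [MeasurableSpace β] [MeasurableSpace γ] {X : Ω → β} {Y : Ω → γ}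
    (hX : Measurable[⨆ i ∈ S, N.sigmaAlgebra i] X)
    (hY : Measurable[⨆ i ∈ T, N.sigmaAlgebra i] Y) : IndepFun X Y P := by
  rw [IndepFun_iff_Indep]
  exact indep_of_indep_of_le_left (indep_of_indep_of_le_right
    (indep_iSup_of_disjoint hN.sigmaAlgebra_le hN.indep hST) hY.comap_le) hX.comap_le

lemma measurable_interference (hN : N.IsModel P lam R) (α : ℝ) : Measurable (N.interference α) :=
  UplinkNetwork.measurable_interference hN.measurable_power hN.measurable_fading
    hN.points_poisson.measurable_point α

lemma indepFun_power_fading (hN : N.IsModel P lam R) (k : ℕ) :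
    IndepFun (N.power k) (N.fading k) P :=
  hN.indepFun_of_disjoint (S := {.power k}) (T := {.fading k}) (by simp)
    (N.measurable_power_iSup rfl) (N.measurable_fading_iSup rfl)

lemma ae_user_ne_zero (hN : N.IsModel P lam R) : ∀ᵐ ω ∂P, N.user ω ≠ 0 :=
  ae_ne_zero_of_isUniform hN.measurable_user hN.user_uniform

lemma ae_userFading_ne_zero (hN : N.IsModel P lam R) : ∀ᵐ ω ∂P, N.userFading ω ≠ 0 := by
  have h := stdComplexGaussian_singleton_zero
  rw [← hN.userFading_law, Measure.map_apply hN.measurable_userFading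
    (measurableSet_singleton 0)] at h
  exact compl_mem_ae_iff.2 h

variable [IsProbabilityMeasure P]

/-- The kth mark depends only on the block {power k, fading k}, and these blocks are disjoint. -/
lemma iIndepFun_mark (hN : N.IsModel P lam R) :
    iIndepFun (fun k ω => (N.power k ω : ℝ≥0∞) * ‖N.fading k ω‖ₑ ^ 2) P := by
  rw [iIndepFun_iff_iIndep]
  refine iIndep_of_iIndep_of_le (hN.indep.iSup_of_pairwise_disjoint hN.sigmaAlgebra_le
    (S := fun k : ℕ => {.power k, .fading k}) fun a b hab => by simp [hab.symm]) fun k => ?_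
  exact (measurable_mul_enorm_sq (N.measurable_power_iSup (by simp))
    (N.measurable_fading_iSup (by simp))).comap_le

lemma map_mark (hN : N.IsModel P lam R) (k : ℕ) :
    P.map (fun ω => (N.power k ω : ℝ≥0∞) * ‖N.fading k ω‖ₑ ^ 2) =
      P.map (fun ω => (N.power 0 ω : ℝ≥0∞) * ‖N.fading 0 ω‖ₑ ^ 2) := by
  have hF : Measurable fun q : ℝ≥0 × ℂ => (q.1 : ℝ≥0∞) * ‖q.2‖ₑ ^ 2 := by fun_prop
  have h : ∀ k, P.map (fun ω => (N.power k ω : ℝ≥0∞) * ‖N.fading k ω‖ₑ ^ 2) =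
      ((P.map (N.power k)).prod stdComplexGaussian).map
        fun q : ℝ≥0 × ℂ => (q.1 : ℝ≥0∞) * ‖q.2‖ₑ ^ 2 := by
    intro k
    have hp := hN.measurable_power k
    have hh := hN.measurable_fading k
    rw [← hN.fading_law k, ← (indepFun_iff_map_prod_eq_prod_map_map hp.aemeasurable
      hh.aemeasurable).1 (hN.indepFun_power_fading k), Measure.map_map hF (hp.prodMk hh)]
    rfl
  rw [h k, h 0, (hN.power_identDistrib k 0).map_eq]

lemma lintegral_mark_rpow (hN : N.IsModel P lam R) (k : ℕ) {t : ℝ} (ht : 0 ≤ t) :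
    ∫⁻ ω, ((N.power k ω : ℝ≥0∞) * ‖N.fading k ω‖ₑ ^ 2) ^ t ∂P =
      (∫⁻ ω, (N.power k ω : ℝ≥0∞) ^ t ∂P) * ENNReal.ofReal (Real.Gamma (1 + t)) := by
  have hF : Measurable fun z : ℂ => (‖z‖ₑ ^ 2) ^ t := by fun_prop
  simp_rw [ENNReal.mul_rpow_of_nonneg _ _ ht]
  have hp := hN.measurable_power k
  have h := (hN.indepFun_power_fading k).lintegral_comp_prodMk hp (hN.measurable_fading k)
    (F := fun q => (q.1 : ℝ≥0∞) ^ t * (‖q.2‖ₑ ^ 2) ^ t) (by fun_prop)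
  rw [h]
  have h2 : ∫⁻ ω, (‖N.fading k ω‖ₑ ^ 2) ^ t ∂P = ENNReal.ofReal (Real.Gamma (1 + t)) := by
    rw [← lintegral_stdComplexGaussian_rpow (by linarith), ← hN.fading_law k,
      lintegral_map hF (hN.measurable_fading k)]
  have h3 : Measurable fun ω => (‖N.fading k ω‖ₑ ^ 2) ^ t := hF.comp (hN.measurable_fading k)
  simp_rw [lintegral_const_mul _ h3, h2]
  rw [lintegral_mul_const _ (by fun_prop)]

/-- Lower bound for the Laplace transform of the interference. -/
lemma negExp_le_lintegral_interference (hN : N.IsModel P lam R) {α : ℝ} (hα : 2 < α) (k : ℕ)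
    {s : ℝ≥0∞} (hs : s ≠ ∞) :
    negExp (ENNReal.ofReal (Real.pi * lam / nsinc (2 / α)) *
        (∫⁻ ω, (N.power k ω : ℝ≥0∞) ^ (2 / α) ∂P) * s ^ (2 / α)) ≤
      ∫⁻ ω, negExp (s * N.interference α ω) ∂P := by
  have hα0 : 0 < α := by linarith
  have ht0 : 0 < 2 / α := by positivity
  have ht1 : 2 / α < 1 := by rw [div_lt_one hα0]; exact hα
  have hMm : ∀ k, Measurable fun ω => (N.power k ω : ℝ≥0∞) * ‖N.fading k ω‖ₑ ^ 2 := fun k =>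
    measurable_mul_enorm_sq (hN.measurable_power k) (hN.measurable_fading k)
  have hind : IndepFun (fun ω k => N.point k ω)
      (fun ω k => (N.power k ω : ℝ≥0∞) * ‖N.fading k ω‖ₑ ^ 2) P :=
    hN.indepFun_of_disjoint (S := {.points}) (T := {.points}ᶜ) disjoint_compl_right
      (N.measurable_points_iSup rfl) (measurable_mul_enorm_sq_pi
        (fun k => N.measurable_power_iSup (by simp)) fun k => N.measurable_fading_iSup (by simp))
  have h := negExp_le_lintegral_shotNoise hN.points_poisson hMm hN.iIndepFun_mark hind hN.map_mark
    (ρ := fun y => s * ‖y‖ₑ ^ (-α)) (by fun_prop)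
  have hpk : ∫⁻ ω, (N.power k ω : ℝ≥0∞) ^ (2 / α) ∂P =
      ∫⁻ ω, (N.power 0 ω : ℝ≥0∞) ^ (2 / α) ∂P :=
    ((hN.power_identDistrib k 0).comp (u := fun p : ℝ≥0 => (p : ℝ≥0∞) ^ (2 / α))
      (by fun_prop)).lintegral_eq
  refine Eq.trans_le ?_ (h.trans_eq ?_)
  · congr 1
    simp_rw [mul_left_comm _ s]
    rw [lintegral_one_sub_lintegral_negExp P hα hs (hMm 0) fun ω =>
      ENNReal.mul_ne_top ENNReal.coe_ne_top (by simp), hN.lintegral_mark_rpow 0 ht0.le, hpk]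
    -- Γ(1 - 2/α) comes from the path loss and Γ(1 + 2/α) from the fading moment; their product
    -- yields the sinc.
    have hc : ENNReal.ofReal (Real.pi * lam / nsinc (2 / α)) = lam *
        (ENNReal.ofReal (Real.pi * Real.Gamma (1 - 2 / α)) *
          ENNReal.ofReal (Real.Gamma (1 + 2 / α))) := by
      rw [← ENNReal.ofReal_mul (mul_nonneg Real.pi_pos.le (Real.Gamma_pos_of_pos (by linarith)).le),
        pi_mul_Gamma_mul_Gamma ht0, ← ENNReal.ofReal_coe_nnreal,
        ← ENNReal.ofReal_mul lam.coe_nonneg]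
      congr 1
      ring
    rw [hc]
    ring
  · simp_rw [interference, ← ENNReal.tsum_mul_left, mul_left_comm s]

/-- Conditioning on everything but the fading of the uplink user. -/
lemma measure_le_enorm_userFading_sq (hN : N.IsModel P lam R) {X : Ω → ℝ≥0∞}
    (hX : Measurable X) (hi : IndepFun X N.userFading P) :
    P {ω | X ω ≤ ‖N.userFading ω‖ₑ ^ 2} = ∫⁻ ω, negExp (X ω) ∂P := by
  have hset : MeasurableSet {q : ℝ≥0∞ × ℂ | q.1 ≤ ‖q.2‖ₑ ^ 2} :=
    measurableSet_le (by fun_prop) (by fun_prop)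
  have h := hi.lintegral_comp_prodMk hX hN.measurable_userFading
    (F := {q : ℝ≥0∞ × ℂ | q.1 ≤ ‖q.2‖ₑ ^ 2}.indicator 1) (measurable_one.indicator hset)
  have hf := hN.measurable_userFading
  have h1 : ∫⁻ ω, {q : ℝ≥0∞ × ℂ | q.1 ≤ ‖q.2‖ₑ ^ 2}.indicator 1 (X ω, N.userFading ω) ∂P =
      P {ω | X ω ≤ ‖N.userFading ω‖ₑ ^ 2} :=
    lintegral_indicator_one (measurableSet_le hX (by fun_prop))
  rw [← h1, h]
  refine lintegral_congr fun ω => ?_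
  have h2 : ∫⁻ ω', {q : ℝ≥0∞ × ℂ | q.1 ≤ ‖q.2‖ₑ ^ 2}.indicator 1 (X ω, N.userFading ω') ∂P =
      P (N.userFading ⁻¹' {z | X ω ≤ ‖z‖ₑ ^ 2}) :=
    lintegral_indicator_one (measurableSet_le measurable_const (by fun_prop))
  rw [h2, ← Measure.map_apply hf (measurableSet_le measurable_const (by fun_prop)),
    hN.userFading_law, stdComplexGaussian_le_enorm_sq]

/-- Once the user's fading is averaged out, the threshold factor and the interference depend on
disjoint sources, hence the separate integration variables. -/
lemma lintegral_negExp_le_coverageProb (hN : N.IsModel P lam R) (α : ℝ) (noise β₀ : ℝ≥0)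
    (hp : ∀ᵐ ω ∂P, N.userPower ω ≠ 0) :
    ∫⁻ ω, ∫⁻ ω', negExp (β₀ * (‖N.user ω‖ₑ ^ α * (N.userPower ω : ℝ≥0∞)⁻¹) *
      (N.interference α ω' + noise)) ∂P ∂P ≤ N.coverageProb P α noise β₀ := by
  have hsm := measurable_const_mul_rpow_mul_inv hN.measurable_user hN.measurable_userPower β₀ α
  have hIm := hN.measurable_interference α
  have hi : IndepFun (fun ω => β₀ * (‖N.user ω‖ₑ ^ α * (N.userPower ω : ℝ≥0∞)⁻¹))
      (N.interference α) P :=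
    hN.indepFun_of_disjoint (S := {.user, .userPower}) (T := {.user, .userPower}ᶜ)
      disjoint_compl_right
      (measurable_const_mul_rpow_mul_inv (N.measurable_user_iSup (by simp))
        (N.measurable_userPower_iSup (by simp)) _ _)
      (N.measurable_interference_iSup (by simp) (by simp) (by simp) α)
  have hX : IndepFun (fun ω => β₀ * (‖N.user ω‖ₑ ^ α * (N.userPower ω : ℝ≥0∞)⁻¹) *
      (N.interference α ω + noise)) N.userFading P := by
    refine hN.indepFun_of_disjoint (S := {.userFading}ᶜ) (T := {.userFading})
      disjoint_compl_left ?_ ?_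
    · refine Measurable.mul (measurable_const_mul_rpow_mul_inv (N.measurable_user_iSup (by simp))
        (N.measurable_userPower_iSup (by simp)) _ _) (Measurable.add_const ?_ _)
      exact N.measurable_interference_iSup (by simp) (by simp) (by simp) α
    · exact (comap_measurable N.userFading).mono (le_iSup₂_of_le Source.userFading rfl le_rfl) le_rfl
  have h := hi.lintegral_comp_prodMk hsm hIm (F := fun q => negExp (q.1 * (q.2 + noise)))
    (by fun_prop)
  simp only at h
  have hXm : Measurable fun ω => β₀ * (‖N.user ω‖ₑ ^ α * (N.userPower ω : ℝ≥0∞)⁻¹) *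
      (N.interference α ω + noise) := hsm.mul (hIm.add_const _)
  rw [← h, ← hN.measure_le_enorm_userFading_sq hXm hX]
  refine measure_mono_ae ?_
  filter_upwards [hp, hN.ae_user_ne_zero, hN.ae_userFading_ne_zero] with ω h1 h2 h3 h4
  exact le_sinr_of_le h2 h1 h3 h4

lemma lintegral_user_mul_inv (hN : N.IsModel P lam R) (hR : 0 < R) {α : ℝ} (hα : 0 < α)
    (c : ℝ≥0) :
    ∫⁻ ω, c * (‖N.user ω‖ₑ ^ α * (N.userPower ω : ℝ≥0∞)⁻¹) ∂P =
      c * (ENNReal.ofReal (2 / (2 + α) * R ^ α) * ∫⁻ ω, (N.userPower ω : ℝ≥0∞)⁻¹ ∂P) := by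
  have h1 := hN.measurable_user
  have h2 := hN.measurable_userPower
  have hi : IndepFun N.user N.userPower P :=
    hN.indepFun_of_disjoint (S := {.user}) (T := {.userPower}) (by simp)
      (N.measurable_user_iSup rfl) (N.measurable_userPower_iSup rfl)
  have h := hi.lintegral_comp_prodMk h1 h2 (F := fun q => ‖q.1‖ₑ ^ α * (q.2 : ℝ≥0∞)⁻¹)
    (by fun_prop)
  simp only at h
  rw [lintegral_const_mul _ (by fun_prop), h]
  simp_rw [lintegral_const_mul _ (show Measurable fun ω => (N.userPower ω : ℝ≥0∞)⁻¹ by fun_prop)]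
  rw [lintegral_mul_const _ (by fun_prop),
    lintegral_enorm_rpow_of_isUniform h1 hR hN.user_uniform hα]

/-- The coverage bound when the inverse transmit power of the user has finite mean. -/
lemma negExp_le_coverageProb (hN : N.IsModel P lam R) (hR : 0 < R) {α : ℝ} (hα : 2 < α)
    (noise β₀ : ℝ≥0) (k : ℕ) (hinv : ∫⁻ ω, (N.userPower ω : ℝ≥0∞)⁻¹ ∂P ≠ ∞) :
    negExp (noise * (β₀ * (ENNReal.ofReal (2 / (2 + α) * R ^ α) *
        ∫⁻ ω, (N.userPower ω : ℝ≥0∞)⁻¹ ∂P)) +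
      ENNReal.ofReal (Real.pi * lam / nsinc (2 / α)) *
        (∫⁻ ω, (N.power k ω : ℝ≥0∞) ^ (2 / α) ∂P) *
        (β₀ * (ENNReal.ofReal (2 / (2 + α) * R ^ α) *
          ∫⁻ ω, (N.userPower ω : ℝ≥0∞)⁻¹ ∂P)) ^ (2 / α)) ≤ N.coverageProb P α noise β₀ := by
  have hα0 : 0 < α := by linarith
  have ht0 : 0 < 2 / α := by positivity
  have ht1 : 2 / α < 1 := by rw [div_lt_one hα0]; exact hα
  have hum := hN.measurable_user
  have hpm := hN.measurable_userPower
  have hIm := hN.measurable_interference α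
  -- Finite mean of p₀⁻¹ excludes p₀ = 0, since 0⁻¹ = ∞.
  have hp : ∀ᵐ ω ∂P, N.userPower ω ≠ 0 := by
    filter_upwards [ae_lt_top (by fun_prop) hinv] with ω hω h0
    simp [h0] at hω
  refine le_trans ?_ (hN.lintegral_negExp_le_coverageProb α noise β₀ hp)
  rw [← hN.lintegral_user_mul_inv hR hα0]
  set s : Ω → ℝ≥0∞ := fun ω => β₀ * (‖N.user ω‖ₑ ^ α * (N.userPower ω : ℝ≥0∞)⁻¹) with hs
  have hsm : Measurable s := by fun_prop
  set A : ℝ≥0∞ := ENNReal.ofReal (Real.pi * lam / nsinc (2 / α)) *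
    ∫⁻ ω, (N.power k ω : ℝ≥0∞) ^ (2 / α) ∂P with hA
  calc negExp (noise * ∫⁻ ω, s ω ∂P + A * (∫⁻ ω, s ω ∂P) ^ (2 / α))
      ≤ negExp (∫⁻ ω, (noise * s ω + A * s ω ^ (2 / α)) ∂P) := by
        refine negExp.antitone ?_
        rw [lintegral_add_left (by fun_prop), lintegral_const_mul _ hsm,
          lintegral_const_mul A (hsm.pow_const _)]
        have h := lintegral_rpow_le_rpow_lintegral (P := P) hsm ht0 ht1.le
        gcongr
    _ ≤ ∫⁻ ω, negExp (noise * s ω + A * s ω ^ (2 / α)) ∂P := negExp.lintegral_le P (by fun_prop)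
    _ ≤ _ := by
        refine lintegral_mono_ae ?_
        filter_upwards [hp] with ω hω
        have hsω : s ω ≠ ∞ := ENNReal.mul_ne_top ENNReal.coe_ne_top (ENNReal.mul_ne_top
          (ENNReal.rpow_ne_top_of_nonneg hα0.le enorm_ne_top) (by simpa using hω))
        simp_rw [mul_add, negExp.add]
        rw [lintegral_mul_const _ (by fun_prop), mul_comm, mul_comm (s ω)]
        gcongr
        exact hN.negExp_le_lintegral_interference hα k hsω

/-- All interferers are silent almost surely and there is no noise; excluding 0/0 then forces a
positive signal over 0, so the SINR is ∞. -/
lemma coverageProb_eq_one_of_lintegral_power_eq_zero (hN : N.IsModel P lam R) {α : ℝ}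
    {β₀ : ℝ≥0} (hwd : ∀ᵐ ω ∂P, ¬ (N.signal α ω = 0 ∧ N.interference α ω + (0 : ℝ≥0) = 0))
    {k : ℕ} {t : ℝ} (ht : 0 < t) (hk : ∫⁻ ω, (N.power k ω : ℝ≥0∞) ^ t ∂P = 0) :
    N.coverageProb P α 0 β₀ = 1 := by
  have hp := hN.measurable_power k
  have hk0 : ∀ᵐ ω ∂P, N.power k ω = 0 := by
    rw [lintegral_eq_zero_iff (by fun_prop)] at hk
    filter_upwards [hk] with ω hω
    simpa [ht, ht.not_gt] using hω
  have hall : ∀ᵐ ω ∂P, ∀ j, N.power j ω = 0 := ae_all_iff.2 fun j =>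
    (hN.power_identDistrib k j).ae_snd (p := fun p => p = 0) (measurableSet_singleton 0) hk0
  rw [coverageProb, ← measure_univ (μ := P)]
  refine measure_congr ?_
  filter_upwards [hall, hwd] with ω h0 h1
  have hI : N.interference α ω = 0 := by simp [interference, h0]
  have hS : N.signal α ω ≠ 0 := fun h => h1 ⟨h, by simp [hI]⟩
  refine eq_true ?_ |>.trans (eq_true trivial).symm
  change (β₀ : ℝ≥0∞) ≤ N.sinr α 0 ω
  simp [sinr, hI, ENNReal.div_zero hS]

end IsModel

end UplinkNetwork

lemma nsinc_pos {t : ℝ} (h0 : 0 < t) (h1 : t < 1) : 0 < nsinc t := by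
  have h := Real.pi_pos
  rw [nsinc, Real.sinc_of_ne_zero (by positivity)]
  refine div_pos (Real.sin_pos_of_pos_of_lt_pi (by positivity) ?_) (by positivity)
  nlinarith

end Model

theorem mainTheorem4 {Ω : Type*} [MeasurableSpace Ω] (P : Measure Ω) [IsProbabilityMeasure P]
    (N : UplinkNetwork Ω) (lam : ℝ≥0) (hlam : 0 < lam) (R : ℝ) (hR : 0 < R)
    (hN : N.IsModel P lam R)
    (α : ℝ) (hα : 2 < α) (noise β₀ : ℝ≥0)
    -- the SINR is almost surely not of the form `0 / 0`
    (hwd : ∀ᵐ ω ∂P, ¬ (N.signal α ω = 0 ∧ N.interference α ω + noise = 0))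
    (k : ℕ) (a₁ a₂ invMean : ℝ≥0∞)
    (ha₁ : a₁ = noise * β₀)
    (ha₂ : a₂ = ENNReal.ofReal (Real.pi * lam * (β₀ : ℝ) ^ (2 / α) / nsinc (2 / α)) *
      ∫⁻ ω, (N.power k ω : ℝ≥0∞) ^ (2 / α) ∂P)
    (hinv : invMean = ∫⁻ ω, (N.userPower ω : ℝ≥0∞)⁻¹ ∂P) :
    EReal.exp (-((a₁ * ENNReal.ofReal (2 / (2 + α) * R ^ α) * invMean +
        a₂ * ENNReal.ofReal ((2 / (2 + α)) ^ (2 / α) * R ^ 2) * invMean ^ (2 / α) : ℝ≥0∞) :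
          EReal)) ≤
      N.coverageProb P α noise β₀ := by
  have hα0 : 0 < α := by linarith
  have ht0 : 0 < 2 / α := by positivity
  have ht1 : 2 / α < 1 := by rw [div_lt_one hα0]; exact hα
  have hsinc := nsinc_pos ht0 ht1
  change negExp _ ≤ _
  have hconst : 0 < 2 / (2 + α) * R ^ α := by positivity
  have hconst' : 0 < (2 / (2 + α)) ^ (2 / α) * R ^ 2 := by positivity
  rcases eq_or_ne β₀ 0 with rfl | hβ
  · refine (negExp.le_one _).trans_eq ?_
    simp [UplinkNetwork.coverageProb]
  -- An infinite mean makes the bound 0 unless both coefficients vanish and 0·∞ = 0 turns it into 1.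
  rcases eq_or_ne invMean ∞ with hinf | hfin
  · rcases eq_or_ne (a₁ * ENNReal.ofReal (2 / (2 + α) * R ^ α)) 0 with h1 | h1
    · rcases eq_or_ne (a₂ * ENNReal.ofReal ((2 / (2 + α)) ^ (2 / α) * R ^ 2)) 0 with h2 | h2
      · have hn : noise = 0 := by
          rw [mul_eq_zero, or_iff_left (by simpa using hconst), ha₁] at h1
          simpa [hβ] using h1
        subst hn
        have hβ' : (0 : ℝ) < β₀ := NNReal.coe_pos.2 (pos_iff_ne_zero.2 hβ)
        have hlam' : (0 : ℝ) < lam := NNReal.coe_pos.2 hlam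
        have hc : 0 < Real.pi * lam * (β₀ : ℝ) ^ (2 / α) / nsinc (2 / α) := by
          have := Real.pi_pos
          positivity
        rw [mul_eq_zero, or_iff_left (by simpa using hconst'), ha₂, mul_eq_zero,
          or_iff_right (by simpa using hc)] at h2
        rw [hN.coverageProb_eq_one_of_lintegral_power_eq_zero hwd ht0 h2]
        exact negExp.le_one _
      · rw [hinf, ENNReal.top_rpow_of_pos ht0, ENNReal.mul_top h2]
        simp
    · rw [hinf, ENNReal.mul_top h1]
      simp
  -- For finite mean the exponents agree after distributing the power 2/α over the product;
  -- (R^α)^(2/α) gives R².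
  · subst hinv
    refine le_trans (negExp.antitone (le_of_eq ?_))
      (hN.negExp_le_coverageProb hR hα noise β₀ k hfin)
    have hr : ENNReal.ofReal ((2 / (2 + α)) ^ (2 / α) * R ^ 2) =
        ENNReal.ofReal (2 / (2 + α) * R ^ α) ^ (2 / α) := by
      rw [ENNReal.ofReal_rpow_of_pos hconst, Real.mul_rpow (by positivity) (by positivity),
        ← Real.rpow_mul hR.le, mul_div_cancel₀ _ hα0.ne', Real.rpow_two]
    have hb : ENNReal.ofReal (Real.pi * lam * (β₀ : ℝ) ^ (2 / α) / nsinc (2 / α)) =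
        (β₀ : ℝ≥0∞) ^ (2 / α) * ENNReal.ofReal (Real.pi * lam / nsinc (2 / α)) := by
      rw [← ENNReal.ofReal_coe_nnreal, ENNReal.ofReal_rpow_of_nonneg β₀.coe_nonneg ht0.le,
        ← ENNReal.ofReal_mul (by positivity)]
      congr 1
      ring
    rw [ENNReal.mul_rpow_of_nonneg _ _ ht0.le, ENNReal.mul_rpow_of_nonneg _ _ ht0.le, ha₁, ha₂, hr,
      hb]
    ring
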